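/- Let $\mathbb D$ be the open unit disk and $\mathbb U$ the unit circle in $\mathbb C$. For $t\in\mathbb R$ and $z\neq 1$ put $f_t(z)=z\,e^{\frac t2\frac{1+z}{1-z}}$, and for $t>0$ put $\Omega_t=\{z\in\mathbb D: f_t(z)\in\mathbb D\}$. Let $s,t>0$. Then $f_s$ is a bijection of $\Omega_s$ onto $\mathbb D$; let $\chi_s:\mathbb D\to\Omega_s$ be its inverse. Moreover $1\notin\overline{\Omega}_s$, so that $f_{s-t}$ is defined on $\overline{\Omega}_s$ and $\chi_{s,t}=f_{s-t}\circ\chi_s$ is defined on $\mathbb D$. Further: 1. $f_{s-t}$ maps $\overline{\Omega}_s$ into $\overline{\mathbb D}$; more precisely, it maps $\overline{\Omega}_s\cap\mathbb D$ into $\mathbb D$ and $\overline{\Omega}_s\cap\mathbb U$ into $\mathbb U$. If $s>4$, it maps all of $\overline{\Omega}_s$ into $\mathbb D$. 2. If, in addition, $s\ge\frac t2$, then $\chi_{s,t}$ is a conformal map (that is, holomorphic and injective) from $\mathbb D$ onto its image, $\chi_{s,t}(\mathbb D)\subseteq\mathbb D$, and $\chi_{s,t}$ extends to a homeomorphism from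 $\overline{\mathbb D}$ onto $\overline{\chi_{s,t}(\mathbb D)}$; furthermore, $1\notin\overline{\chi_{s,t}(\mathbb D)}$. -/

import Mathlib

open Set Metric

namespace FreeUnitary

/-- The map `f_t(z) = z * exp((t/2) * (1+z)/(1-z))`, for real `t` of any sign. It is singular at
`z = 1` only, where the value given by the formula below has no meaning. -/
noncomputable def f (t : ℝ) (z : ℂ) : ℂ :=
  z * Complex.exp ((t : ℂ) / 2 * ((1 + z) / (1 - z)))

/-- The region `Ω_t = {z ∈ 𝔻 : f_t(z) ∈ 𝔻}`, for `t > 0`. -/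
def Omega (t : ℝ) : Set ℂ :=
  {z | z ∈ ball (0 : ℂ) 1 ∧ f t z ∈ ball (0 : ℂ) 1}

/-- The map `χ_t` on the unit disk: the inverse of the bijection `f_t : Ω_t → 𝔻`, for `t > 0`. -/
noncomputable def chi (t : ℝ) : ℂ → ℂ :=
  Function.invFunOn (f t) (Omega t)

/-- `χ_{s,t} = f_{s-t} ∘ χ_s`, a function on the unit disk. -/
noncomputable def chi2 (s t : ℝ) : ℂ → ℂ :=
  f (s - t) ∘ chi s

/-- `g` is a conformal map of the open set `U` onto its image: holomorphic and injective. -/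
def IsConformalOn (g : ℂ → ℂ) (U : Set ℂ) : Prop :=
  DifferentiableOn ℂ g U ∧ InjOn g U

/-- The restriction of `g` to the open unit disk extends to a homeomorphism from the closed unit
disk onto the closure of the image of the open disk. -/
def ExtendsToHomeo (g : ℂ → ℂ) : Prop :=
  ∃ e : closedBall (0 : ℂ) 1 ≃ₜ closure (g '' ball (0 : ℂ) 1),
    ∀ z : closedBall (0 : ℂ) 1, (z : ℂ) ∈ ball (0 : ℂ) 1 → (e z : ℂ) = g z

end FreeUnitary

/-! Write `z = e^{-a}`, `u = Re a ≥ 0`, `S(u) = sinh u / u`. For `u > 0`, `|f_s(z)| ≤ 1` says `s |z|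
S(u) ≤ |1 - z|²`; by continuity this persists on the part of the closure of `Ω_s` on the circle,
where `S(0) = 1`, so it excludes `z = 1`. Everything else rests on the injectivity of `f_p` on this
closure for `|p| ≤ s` (`injOn_f_closure`). If `f_p(z) = f_p(w)` with `w = e^{-b}`, `v = Re b`, then
for suitable logarithms `(a - b)(1 - z)(1 - w) = p (z - w)`. Bounding `|1 - z|²` and `|1 - w|²` from
below contradicts `4 |sinh ((a - b)/2)|² < |a - b|² S(u) S(v)`, unless `a = b`. The case `p = s`
gives `χ_s`; the case `p = s - t` gives `χ_{s,t}`, and compactness gives the homeomorphism. An angle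
estimate on the circle keeps `1` out of the image. -/

namespace FreeUnitary

/-! ### ### Estimates for `sinh` -/

/-- The function `sinh x / x`, continued by `1` at `0`. -/
noncomputable def sinhc (x : ℝ) : ℝ := if x = 0 then 1 else Real.sinh x / x

lemma sinhc_zero : sinhc 0 = 1 := by simp [sinhc]

lemma sinhc_mul_self (x : ℝ) : sinhc x * x = Real.sinh x := by
  by_cases h : x = 0
  · simp [h]
  · simp [sinhc, h]

lemma one_le_sinhc {x : ℝ} (hx : 0 ≤ x) : 1 ≤ sinhc x := by
  rcases hx.eq_or_lt with rfl | hx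
  · rw [sinhc_zero]
  · have h := Real.self_le_sinh_iff.2 hx.le
    rw [← sinhc_mul_self] at h
    nlinarith

lemma sinh_lt_mul_cosh {x : ℝ} (hx : 0 < x) : Real.sinh x < x * Real.cosh x := by
  have h : StrictMonoOn (fun y : ℝ => y * Real.cosh y - Real.sinh y) (Ici 0) := by
    apply strictMonoOn_of_deriv_pos (convex_Ici 0)
    · exact ((continuous_id.mul Real.continuous_cosh).sub Real.continuous_sinh).continuousOn
    · intro y hy
      rw [interior_Ici] at hy
      have h1 : HasDerivAt (fun y : ℝ => y * Real.cosh y - Real.sinh y)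
          (1 * Real.cosh y + y * Real.sinh y - Real.cosh y) y :=
        ((hasDerivAt_id y).mul (Real.hasDerivAt_cosh y)).sub (Real.hasDerivAt_sinh y)
      rw [h1.deriv]
      have := mul_pos (mem_Ioi.1 hy) (Real.sinh_pos_iff.2 hy)
      linarith
  have := h (mem_Ici.2 le_rfl) (mem_Ici.2 hx.le) hx
  simp at this
  linarith

lemma strictConvexOn_sinh : StrictConvexOn ℝ (Ici 0) Real.sinh := by
  apply StrictMonoOn.strictConvexOn_of_deriv (convex_Ici 0) Real.continuous_sinh.continuousOn
  rw [interior_Ici, Real.deriv_sinh]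
  exact Real.cosh_strictMonoOn.mono Ioi_subset_Ici_self

lemma sinhc_le_sinhc {x y : ℝ} (hx : 0 ≤ x) (hxy : x ≤ y) : sinhc x ≤ sinhc y := by
  rcases hx.eq_or_lt with rfl | hx
  · rw [sinhc_zero]; exact one_le_sinhc hxy
  · have hy := hx.trans_le hxy
    have h := strictConvexOn_sinh.convexOn.2 (mem_Ici.2 le_rfl) (mem_Ici.2 hy.le)
      (sub_nonneg.2 ((div_le_one hy).2 hxy)) (div_nonneg hx.le hy.le) (sub_add_cancel 1 (x / y))
    simp only [smul_eq_mul, mul_zero, Real.sinh_zero, zero_add, div_mul_cancel₀ _ hy.ne'] at h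
    rw [sinhc, sinhc, if_neg hx.ne', if_neg hy.ne', div_le_div_iff₀ hx hy]
    rw [div_mul_eq_mul_div, le_div_iff₀ hy] at h
    linarith

/-- The right side is `x sinh x cosh x`, so this is `sinh x < x cosh x` multiplied by `sinh x`. -/
lemma sinh_sq_lt_sq_mul_sinhc {x : ℝ} (hx : 0 < x) :
    Real.sinh x ^ 2 < x ^ 2 * sinhc (2 * x) := by
  have h1 := sinhc_mul_self (2 * x)
  rw [Real.sinh_two_mul] at h1
  have h2 := mul_lt_mul_of_pos_left (sinh_lt_mul_cosh hx) (Real.sinh_pos_iff.2 hx)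
  nlinarith

/-- If `x` is at most half the larger of `u, v`, then `|sinh (x + i y)|² < |x + i y|² S(u) S(v)`
for `x + i y ≠ 0`, where `S` is `sinhc`. -/
lemma sinh_sq_add_sin_sq_lt {x y u v : ℝ} (hu : 0 ≤ u) (hv : 0 ≤ v) (hx : 2 * x = u - v)
    (hxy : x ≠ 0 ∨ y ≠ 0) :
    Real.sinh x ^ 2 + Real.sin y ^ 2 < (x ^ 2 + y ^ 2) * (sinhc u * sinhc v) := by
  have hSu := one_le_sinhc hu
  have hSv := one_le_sinhc hv
  have hS : 1 ≤ sinhc u * sinhc v := one_le_mul_of_one_le_of_one_le hSu hSv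
  have hy : Real.sin y ^ 2 ≤ y ^ 2 := Real.sin_sq_le_sq
  by_cases h0 : x = 0
  · have hy' : Real.sin y ^ 2 < y ^ 2 := Real.sin_sq_lt_sq (by tauto)
    simp only [h0, Real.sinh_zero]
    nlinarith
  · have key := sinh_sq_lt_sq_mul_sinhc (abs_pos.2 h0)
    have habs : Real.sinh |x| ^ 2 = Real.sinh x ^ 2 := by
      rw [← Real.abs_sinh, sq_abs]
    rw [habs, sq_abs] at key
    -- Since `u, v ≥ 0`, the larger of them is at least `|u - v| = 2|x|`; the other factor is at
    -- least `1`.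
    have hm : sinhc (2 * |x|) ≤ sinhc u * sinhc v := by
      rcases abs_cases x with ⟨h, _⟩ | ⟨h, _⟩
      · have : sinhc (2 * |x|) ≤ sinhc u := sinhc_le_sinhc (by positivity) (by linarith)
        nlinarith
      · have : sinhc (2 * |x|) ≤ sinhc v := sinhc_le_sinhc (by positivity) (by linarith)
        nlinarith
    have := mul_le_mul_of_nonneg_left hm (sq_nonneg x)
    nlinarith [sq_nonneg y]

lemma normSq_sinh (z : ℂ) :
    ‖Complex.sinh z‖ ^ 2 = Real.sinh z.re ^ 2 + Real.sin z.im ^ 2 := by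
  rw [← Complex.normSq_eq_norm_sq]
  conv_lhs => rw [← Complex.re_add_im z]
  rw [Complex.sinh_add, Complex.sinh_mul_I, Complex.cosh_mul_I]
  simp only [← Complex.ofReal_sinh, ← Complex.ofReal_cosh, ← Complex.ofReal_sin,
    ← Complex.ofReal_cos, Complex.normSq_apply]
  simp only [Complex.add_re, Complex.add_im, Complex.mul_re, Complex.mul_im, Complex.ofReal_re,
    Complex.ofReal_im, Complex.I_re, Complex.I_im]
  have h1 := Real.cosh_sq z.re
  have h2 := Real.sin_sq_add_cos_sq z.im
  ring_nf
  rw [h1]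
  linear_combination (Real.sinh z.re ^ 2) * h2

lemma norm_sinh_half_sq_lt {u v : ℝ} (hu : 0 ≤ u) (hv : 0 ≤ v) {d : ℂ} (hd : d.re = u - v)
    (h0 : d ≠ 0) :
    4 * ‖Complex.sinh (d / 2)‖ ^ 2 < ‖d‖ ^ 2 * (sinhc u * sinhc v) := by
  have e1 : (d / 2).re = d.re / 2 := by simp
  have e2 : (d / 2).im = d.im / 2 := by simp
  have h := sinh_sq_add_sin_sq_lt (x := d.re / 2) (y := d.im / 2) hu hv (by linarith) (by
    by_contra! h
    exact h0 (Complex.ext (by simpa using h.1) (by simpa using h.2)))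
  rw [normSq_sinh, e1, e2, ← Complex.normSq_eq_norm_sq, Complex.normSq_apply]
  nlinarith

/-- The difference is `-2 e^{-(a+b)/2} sinh ((a-b)/2)`; squaring removes the half exponents. -/
lemma norm_exp_sub_exp_sq (a b : ℂ) :
    ‖Complex.exp (-a) - Complex.exp (-b)‖ ^ 2 =
      4 * ‖Complex.exp (-a)‖ * ‖Complex.exp (-b)‖ * ‖Complex.sinh ((a - b) / 2)‖ ^ 2 := by
  have h : (Complex.exp (-a) - Complex.exp (-b)) ^ 2 =
      4 * Complex.exp (-a) * Complex.exp (-b) * Complex.sinh ((a - b) / 2) ^ 2 := by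
    have ha : Complex.exp (-a) = Complex.exp (-a / 2) ^ 2 := by
      rw [← Complex.exp_nat_mul]; congr 1; push_cast; ring
    have hb : Complex.exp (-b) = Complex.exp (-b / 2) ^ 2 := by
      rw [← Complex.exp_nat_mul]; congr 1; push_cast; ring
    have h1 : Complex.exp ((a - b) / 2) * Complex.exp (-a / 2) = Complex.exp (-b / 2) := by
      rw [← Complex.exp_add]; congr 1; ring
    have h2 : Complex.exp (-((a - b) / 2)) * Complex.exp (-b / 2) = Complex.exp (-a / 2) := by
      rw [← Complex.exp_add]; congr 1; ring
    have h3 : Complex.exp (-((a - b) / 2)) * Complex.exp ((a - b) / 2) = 1 := by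
      rw [← Complex.exp_add, neg_add_cancel, Complex.exp_zero]
    have key : 2 * Complex.sinh ((a - b) / 2) * (Complex.exp (-a / 2) * Complex.exp (-b / 2)) =
        Complex.exp (-b / 2) ^ 2 - Complex.exp (-a / 2) ^ 2 := by
      rw [Complex.two_sinh]
      linear_combination Complex.exp (-b / 2) * h1 - Complex.exp (-a / 2) * h2
    rw [ha, hb]
    linear_combination (-(2 * Complex.sinh ((a - b) / 2) *
      (Complex.exp (-a / 2) * Complex.exp (-b / 2)) + Complex.exp (-b / 2) ^ 2 -
      Complex.exp (-a / 2) ^ 2)) * key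
  have := congrArg norm h
  simpa only [norm_pow, norm_mul, Complex.norm_ofNat] using this

/-! ### The modulus of `f` -/

lemma re_cayley (z : ℂ) : ((1 + z) / (1 - z)).re = (1 - ‖z‖ ^ 2) / ‖1 - z‖ ^ 2 := by
  rw [Complex.div_re, ← add_div, Complex.normSq_eq_norm_sq, ← Complex.normSq_eq_norm_sq z,
    Complex.normSq_apply]
  congr 1
  simp
  ring

lemma norm_f (t : ℝ) (z : ℂ) :
    ‖f t z‖ = ‖z‖ * Real.exp (t / 2 * ((1 - ‖z‖ ^ 2) / ‖1 - z‖ ^ 2)) := by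
  rw [f, norm_mul, Complex.norm_exp, ← re_cayley]
  congr 2
  have : (t : ℂ) / 2 = ((t / 2 : ℝ) : ℂ) := by push_cast; rfl
  rw [this, Complex.re_ofReal_mul]

lemma norm_f_of_norm_eq_one (t : ℝ) {z : ℂ} (hz : ‖z‖ = 1) : ‖f t z‖ = 1 := by
  rw [norm_f, hz]; simp

lemma hasStrictDerivAt_f (t : ℝ) {z : ℂ} (hz : z ≠ 1) :
    HasStrictDerivAt (f t)
      (Complex.exp ((t : ℂ) / 2 * ((1 + z) / (1 - z))) * (1 + t * z / (1 - z) ^ 2)) z := by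
  have h1 : 1 - z ≠ 0 := sub_ne_zero.2 hz.symm
  have hi := hasStrictDerivAt_id z
  have h := hi.mul ((((hi.const_add 1).div (hi.const_sub 1) h1).const_mul ((t : ℂ) / 2)).cexp)
  refine h.congr_deriv ?_
  simp only [id, Pi.div_apply]
  field_simp
  ring

lemma continuousAt_f (t : ℝ) {z : ℂ} (hz : z ≠ 1) : ContinuousAt (f t) z :=
  (hasStrictDerivAt_f t hz).hasDerivAt.continuousAt

lemma exists_neg_log {z : ℂ} (hz : z ≠ 0) : ∃ a : ℂ, Complex.exp (-a) = z :=
  ⟨-Complex.log z, by rw [neg_neg, Complex.exp_log hz]⟩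

/-- `1 - r² = 2 r u S(u)` with `r = exp (-u)`. -/
lemma one_sub_exp_neg_sq (u : ℝ) :
    1 - Real.exp (-u) ^ 2 = 2 * Real.exp (-u) * (sinhc u * u) := by
  rw [sinhc_mul_self, Real.sinh_eq]
  have : Real.exp (-u) * Real.exp u = 1 := by rw [← Real.exp_add]; simp
  linear_combination -this

/-- The modulus of `f` at `z`, in terms of `u = -log |z|`. -/
lemma norm_f_exp (t u : ℝ) {z : ℂ} (hu : ‖z‖ = Real.exp (-u)) :
    ‖f t z‖ = Real.exp (u * (t * ‖z‖ * sinhc u / ‖1 - z‖ ^ 2 - 1)) := by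
  rw [norm_f]
  conv_lhs => rw [hu, one_sub_exp_neg_sq, ← Real.exp_add]
  rw [hu]
  congr 1
  ring

/-! ### The closure of `Ω_s` -/

lemma exists_norm_eq_exp_neg {z : ℂ} (hz : z ≠ 0) : ‖z‖ = Real.exp (-(-Real.log ‖z‖)) := by
  rw [neg_neg, Real.exp_log (norm_pos_iff.2 hz)]

lemma norm_lt_of_mem_Omega {s : ℝ} {z : ℂ} (hz : z ∈ Omega s) : ‖z‖ < 1 :=
  mem_ball_zero_iff.1 hz.1

lemma ne_one_of_norm_lt_one {z : ℂ} (hz : ‖z‖ < 1) : z ≠ 1 := by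
  rintro rfl; simp at hz

lemma norm_sub_sq_pos {z : ℂ} (hz : z ≠ 1) : 0 < ‖1 - z‖ ^ 2 := by
  have := norm_pos_iff.2 (sub_ne_zero.2 hz.symm)
  positivity

/-- The exponent in `norm_f_exp` is negative, and `S ≥ 1`. Free of `u`, the bound passes to the
closure in its weak form; strict, it makes the derivative of `f_s` nonzero. -/
lemma mul_norm_lt_of_mem_Omega {s : ℝ} (hs : 0 < s) {z : ℂ} (hz : z ∈ Omega s) :
    s * ‖z‖ < ‖1 - z‖ ^ 2 := by
  by_cases h0 : z = 0
  · simp [h0]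
  have hlt := norm_lt_of_mem_Omega hz
  have hu : 0 < -Real.log ‖z‖ := neg_pos.2 (Real.log_neg (norm_pos_iff.2 h0) hlt)
  have h := mem_ball_zero_iff.1 hz.2
  rw [norm_f_exp s _ (exists_norm_eq_exp_neg h0), Real.exp_lt_one_iff] at h
  have h2 : s * ‖z‖ * sinhc (-Real.log ‖z‖) / ‖1 - z‖ ^ 2 < 1 := by nlinarith
  rw [div_lt_one (norm_sub_sq_pos (ne_one_of_norm_lt_one hlt))] at h2
  have h3 := mul_le_mul_of_nonneg_left (one_le_sinhc hu.le) (mul_nonneg hs.le (norm_nonneg z))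
  linarith

lemma norm_le_of_mem_closure {s : ℝ} {z : ℂ} (hz : z ∈ closure (Omega s)) : ‖z‖ ≤ 1 :=
  mem_closedBall_zero_iff.1 (closure_minimal (fun _ h => ball_subset_closedBall h.1)
    isClosed_closedBall hz)

lemma mul_norm_le_of_mem_closure {s : ℝ} (hs : 0 < s) {z : ℂ} (hz : z ∈ closure (Omega s)) :
    s * ‖z‖ ≤ ‖1 - z‖ ^ 2 :=
  closure_minimal (t := {z : ℂ | s * ‖z‖ ≤ ‖1 - z‖ ^ 2})
    (fun _ h => (mul_norm_lt_of_mem_Omega hs h).le)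
    (isClosed_le (by fun_prop) (by fun_prop)) hz

lemma ne_one_of_mem_closure {s : ℝ} (hs : 0 < s) {z : ℂ} (hz : z ∈ closure (Omega s)) :
    z ≠ 1 := by
  rintro rfl
  have := mul_norm_le_of_mem_closure hs hz
  simp at this
  linarith

lemma continuousOn_f_closure {s : ℝ} (hs : 0 < s) (p : ℝ) :
    ContinuousOn (f p) (closure (Omega s)) := fun _ hz =>
  (continuousAt_f p (ne_one_of_mem_closure hs hz)).continuousWithinAt

lemma norm_f_le_of_mem_closure {s : ℝ} (hs : 0 < s) {z : ℂ} (hz : z ∈ closure (Omega s)) :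
    ‖f s z‖ ≤ 1 := by
  have h : MapsTo (f s) (Omega s) (closedBall 0 1) := fun _ h => ball_subset_closedBall h.2
  have := h.closure_of_continuousOn (continuousOn_f_closure hs s) hz
  rwa [closure_closedBall, mem_closedBall_zero_iff] at this

lemma norm_f_lt_of_mem_closure {s p : ℝ} (hs : 0 < s) (hp : p < s) {z : ℂ}
    (hz : z ∈ closure (Omega s)) (h1 : ‖z‖ < 1) : ‖f p z‖ < 1 := by
  by_cases h0 : z = 0
  · simp [h0, f]
  refine lt_of_lt_of_le ?_ (norm_f_le_of_mem_closure hs hz)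
  -- For `0 < |z| < 1` the exponent has positive slope in the parameter, so `|f_p(z)| < |f_s(z)|`.
  rw [norm_f, norm_f]
  have hz1 := norm_sub_sq_pos (ne_one_of_norm_lt_one h1)
  have h2 : 0 < 1 - ‖z‖ ^ 2 := by nlinarith [norm_nonneg z]
  have := norm_pos_iff.2 h0
  gcongr

lemma isCompact_closure_Omega (s : ℝ) : IsCompact (closure (Omega s)) :=
  (isBounded_ball.subset fun _ h => h.1).isCompact_closure

lemma isOpen_Omega (s : ℝ) : IsOpen (Omega s) := by
  have h : ContinuousOn (f s) (ball 0 1) := fun z hz =>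
    (continuousAt_f s (ne_one_of_norm_lt_one (mem_ball_zero_iff.1 hz))).continuousWithinAt
  exact h.isOpen_inter_preimage isOpen_ball isOpen_ball

lemma mul_sinhc_le_of_mem_closure {s : ℝ} (hs : 0 < s) {a : ℂ}
    (hz : Complex.exp (-a) ∈ closure (Omega s)) :
    0 ≤ a.re ∧ s * ‖Complex.exp (-a)‖ * sinhc a.re ≤ ‖1 - Complex.exp (-a)‖ ^ 2 := by
  have hn : ‖Complex.exp (-a)‖ = Real.exp (-a.re) := by rw [Complex.norm_exp, Complex.neg_re]
  have hu : 0 ≤ a.re := by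
    have := norm_le_of_mem_closure hz
    rw [hn, Real.exp_le_one_iff] at this
    linarith
  refine ⟨hu, ?_⟩
  rcases hu.eq_or_lt with h | h
  -- On the circle `|f_s| = 1` carries no information; the bound comes from the limit of interior
  -- points.
  · rw [← h, sinhc_zero, mul_one]
    exact mul_norm_le_of_mem_closure hs hz
  · have h1 := norm_f_le_of_mem_closure hs hz
    rw [norm_f_exp s _ hn, Real.exp_le_one_iff] at h1
    rw [← div_le_one (norm_sub_sq_pos (ne_one_of_mem_closure hs hz))]
    have := nonpos_of_mul_nonpos_right h1 h
    linarith

/-! ### ### Injectivity on the closure -/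

theorem injOn_f_closure {s p : ℝ} (hs : 0 < s) (hp : |p| ≤ s) :
    InjOn (f p) (closure (Omega s)) := by
  intro z hz w hw hzw
  by_cases hz0 : z = 0
  · subst hz0
    have : w = 0 := by simpa [f, Complex.exp_ne_zero] using hzw.symm
    exact this.symm
  by_cases hw0 : w = 0
  · subst hw0
    simpa [f, Complex.exp_ne_zero] using hzw
  obtain ⟨a, rfl⟩ := exists_neg_log hz0
  obtain ⟨b', rfl⟩ := exists_neg_log hw0
  have hz1 : 1 - Complex.exp (-a) ≠ 0 := sub_ne_zero.2 (ne_one_of_mem_closure hs hz).symm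
  have hw1 : 1 - Complex.exp (-b') ≠ 0 := sub_ne_zero.2 (ne_one_of_mem_closure hs hw).symm
  have hexp := hzw
  rw [f, f, ← Complex.exp_add, ← Complex.exp_add, Complex.exp_eq_exp_iff_exists_int] at hexp
  obtain ⟨n, hn⟩ := hexp
  -- Another logarithm of `w`, chosen so that the exponents themselves agree.
  obtain ⟨b, hb⟩ : ∃ b : ℂ, b = b' - n * (2 * Real.pi * Complex.I) := ⟨_, rfl⟩
  have hbb : Complex.exp (-b) = Complex.exp (-b') :=
    Complex.exp_eq_exp_iff_exists_int.2 ⟨n, by rw [hb]; ring⟩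
  rw [← hbb] at hw hw1 hn ⊢
  have hd : (a - b) * ((1 - Complex.exp (-a)) * (1 - Complex.exp (-b))) =
      p * (Complex.exp (-a) - Complex.exp (-b)) := by
    have e : a - b = (p : ℂ) / 2 * ((1 + Complex.exp (-a)) / (1 - Complex.exp (-a))) -
        (p : ℂ) / 2 * ((1 + Complex.exp (-b)) / (1 - Complex.exp (-b))) := by
      linear_combination -hn - hb
    rw [e]
    field_simp
    ring
  by_contra hne
  have hab : a - b ≠ 0 := fun h => hne (by rw [sub_eq_zero.1 h])
  obtain ⟨hu, hA⟩ := mul_sinhc_le_of_mem_closure hs hz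
  obtain ⟨hv, hB⟩ := mul_sinhc_le_of_mem_closure hs hw
  have hlt := norm_sinh_half_sq_lt hu hv (Complex.sub_re a b) hab
  have hnorm := congrArg (fun x => ‖x‖ ^ 2) hd
  simp only [norm_mul, mul_pow, norm_exp_sub_exp_sq, Complex.norm_real, Real.norm_eq_abs] at hnorm
  have hx : 0 < ‖Complex.exp (-a)‖ := norm_pos_iff.2 (Complex.exp_ne_zero _)
  have hy : 0 < ‖Complex.exp (-b)‖ := norm_pos_iff.2 (Complex.exp_ne_zero _)
  have hSu := one_le_sinhc hu
  have hSv := one_le_sinhc hv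
  set x := ‖Complex.exp (-a)‖
  set y := ‖Complex.exp (-b)‖
  have hprod : s * x * sinhc a.re * (s * y * sinhc b.re) ≤
      ‖1 - Complex.exp (-a)‖ ^ 2 * ‖1 - Complex.exp (-b)‖ ^ 2 := by gcongr
  have hpp : |p| ^ 2 ≤ s ^ 2 := by gcongr
  have h1 := mul_le_mul_of_nonneg_left hprod (sq_nonneg ‖a - b‖)
  have h2 : |p| ^ 2 * (4 * x * y * ‖Complex.sinh ((a - b) / 2)‖ ^ 2) ≤
      s ^ 2 * (4 * x * y * ‖Complex.sinh ((a - b) / 2)‖ ^ 2) := by gcongr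
  have h3 : s ^ 2 * x * y * (4 * ‖Complex.sinh ((a - b) / 2)‖ ^ 2) <
      s ^ 2 * x * y * (‖a - b‖ ^ 2 * (sinhc a.re * sinhc b.re)) := by gcongr
  linarith

/-! ### The bijection `f_s : Ω_s → 𝔻` -/

lemma exists_hasStrictDerivAt_f {s : ℝ} (hs : 0 < s) {z : ℂ} (hz : z ∈ Omega s) :
    ∃ f' : ℂ, f' ≠ 0 ∧ HasStrictDerivAt (f s) f' z := by
  have hz1 := ne_one_of_norm_lt_one (norm_lt_of_mem_Omega hz)
  -- A zero of the derivative would force `s |z| = |1 - z|²`.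
  refine ⟨_, mul_ne_zero (Complex.exp_ne_zero _) fun h => ?_, hasStrictDerivAt_f s hz1⟩
  have h1 : 1 - z ≠ 0 := sub_ne_zero.2 hz1.symm
  have h2 : (s : ℂ) * z = -(1 - z) ^ 2 := by
    field_simp at h
    linear_combination h
  have h3 := congrArg norm h2
  rw [norm_neg, norm_mul, norm_pow, Complex.norm_real, Real.norm_eq_abs, abs_of_pos hs] at h3
  exact (mul_norm_lt_of_mem_Omega hs hz).ne h3

lemma image_mem_nhds_f {s : ℝ} (hs : 0 < s) {z : ℂ} (hz : z ∈ Omega s) {U : Set ℂ}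
    (hU : U ∈ nhds z) : f s '' U ∈ nhds (f s z) := by
  obtain ⟨f', h0, h⟩ := exists_hasStrictDerivAt_f hs hz
  rw [← h.map_nhds_eq h0]
  exact Filter.image_mem_map hU

/-- Surjectivity is by connectedness of the disk. The image is open, and relatively closed: its
limit points are images of points of the compact closure, and those on the circle stay on the
circle. -/
theorem bijOn_f {s : ℝ} (hs : 0 < s) : BijOn (f s) (Omega s) (ball 0 1) := by
  refine ⟨fun _ h => h.2, (injOn_f_closure hs (abs_of_pos hs).le).mono subset_closure, ?_⟩
  have h0 : (0 : ℂ) ∈ Omega s := by simp [Omega, f]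
  refine (convex_ball (0 : ℂ) 1).isPreconnected.subset_of_closure_inter_subset
    (isOpen_iff_mem_nhds.2 ?_) ⟨f s 0, h0.2, mem_image_of_mem _ h0⟩ ?_
  · rintro _ ⟨z, hz, rfl⟩
    exact image_mem_nhds_f hs hz ((isOpen_Omega s).mem_nhds hz)
  · rintro w ⟨hw, hw1⟩
    rw [← image_closure_of_isCompact (isCompact_closure_Omega s)
      (continuousOn_f_closure hs s)] at hw
    obtain ⟨z, hz, rfl⟩ := hw
    refine mem_image_of_mem _ ⟨mem_ball_zero_iff.2 ?_, hw1⟩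
    refine (norm_le_of_mem_closure hz).lt_of_ne fun h => ?_
    rw [mem_ball_zero_iff, norm_f_of_norm_eq_one s h] at hw1
    exact lt_irrefl _ hw1

lemma chi_mem {s : ℝ} (hs : 0 < s) {w : ℂ} (hw : w ∈ ball (0 : ℂ) 1) : chi s w ∈ Omega s :=
  Function.invFunOn_mem ((bijOn_f hs).surjOn hw)

lemma f_chi {s : ℝ} (hs : 0 < s) {w : ℂ} (hw : w ∈ ball (0 : ℂ) 1) : f s (chi s w) = w :=
  Function.invFunOn_eq ((bijOn_f hs).surjOn hw)

lemma chi_f {s : ℝ} (hs : 0 < s) {z : ℂ} (hz : z ∈ Omega s) : chi s (f s z) = z :=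
  (bijOn_f hs).injOn (chi_mem hs hz.2) hz (f_chi hs hz.2)

lemma chi_image {s : ℝ} (hs : 0 < s) : chi s '' ball 0 1 = Omega s := by
  apply Subset.antisymm
  · rintro _ ⟨w, hw, rfl⟩
    exact chi_mem hs hw
  · exact fun z hz => ⟨f s z, hz.2, chi_f hs hz⟩

lemma differentiableAt_chi {s : ℝ} (hs : 0 < s) {w : ℂ} (hw : w ∈ ball (0 : ℂ) 1) :
    DifferentiableAt ℂ (chi s) w := by
  have hz := chi_mem hs hw
  obtain ⟨f', h0, h⟩ := exists_hasStrictDerivAt_f hs hz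
  -- Continuity of the inverse is the openness of `f_s`.
  have hc : ContinuousAt (chi s) w := by
    intro U hU
    have := image_mem_nhds_f hs hz (Filter.inter_mem hU ((isOpen_Omega s).mem_nhds hz))
    rw [f_chi hs hw] at this
    refine Filter.mem_map.2 (Filter.mem_of_superset this ?_)
    rintro _ ⟨x, ⟨hxU, hx⟩, rfl⟩
    rwa [mem_preimage, chi_f hs hx]
  exact (HasDerivAt.of_local_left_inverse hc h.hasDerivAt h0 (by
    filter_upwards [isOpen_ball.mem_nhds hw] with y hy using f_chi hs hy)).differentiableAt

/-! ### Points of the closure are not mapped to `1` -/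

lemma abs_sin_mul_cos_lt {x : ℝ} (hx : x ≠ 0) : |Real.sin x * Real.cos x| < |x| := by
  rw [abs_mul]
  have h1 := Real.abs_sin_lt_abs hx
  have h2 := Real.abs_cos_le_one x
  nlinarith [abs_nonneg (Real.sin x)]

lemma abs_sin_mul_cos_le (x : ℝ) : |Real.sin x * Real.cos x| ≤ 1 / 2 := by
  have h := Real.sin_sq_add_cos_sq x
  rw [abs_le]
  constructor <;> nlinarith [sq_nonneg (Real.sin x + Real.cos x),
    sq_nonneg (Real.sin x - Real.cos x)]

/-- With `z = e^{2ix}`, `f_p(z) = e^{2i(x+y)}` where `y = (p/4) cot x`. The closure bound reads `s ≤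
4 sin² x`, so `|y| ≤ |sin x cos x| < |x|`: the angle is nonzero and too small to be another multiple
of `2π`. -/
theorem f_ne_one_of_mem_closure {s p : ℝ} (hs : 0 < s) (hp : |p| ≤ s) {z : ℂ}
    (hz : z ∈ closure (Omega s)) (h1 : ‖z‖ = 1) : f p z ≠ 1 := by
  intro hf
  have hne := ne_one_of_mem_closure hs hz
  have hle := mul_norm_le_of_mem_closure hs hz
  rw [h1, mul_one] at hle
  obtain ⟨x, hx⟩ : ∃ x : ℝ, x = z.arg / 2 := ⟨_, rfl⟩
  have hzx : z = Complex.exp (x * Complex.I) ^ 2 := by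
    rw [← Complex.exp_nat_mul, hx]
    conv_lhs => rw [← Complex.norm_mul_exp_arg_mul_I z, h1]
    push_cast
    rw [one_mul]
    congr 1
    ring
  have hxpi : |x| ≤ Real.pi / 2 := by
    rw [hx, abs_div, abs_two]
    have := Complex.abs_arg_le_pi z
    linarith
  have hx0 : x ≠ 0 := by
    rintro rfl
    exact hne (by simp [hzx])
  have hE : Complex.exp (x * Complex.I) = Real.cos x + Real.sin x * Complex.I := by
    rw [Complex.exp_mul_I, Complex.ofReal_cos, Complex.ofReal_sin]
  have hcs := Real.sin_sq_add_cos_sq x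
  have hcsC : (Real.sin x : ℂ) ^ 2 + (Real.cos x : ℂ) ^ 2 = 1 := by exact_mod_cast hcs
  have h1z : 1 - z = -2 * Complex.I * Real.sin x * Complex.exp (x * Complex.I) := by
    rw [hzx, hE]
    linear_combination (Real.sin x : ℂ) ^ 2 * Complex.I_sq - hcsC
  have h1z' : 1 + z = 2 * Real.cos x * Complex.exp (x * Complex.I) := by
    rw [hzx, hE]
    linear_combination (Real.sin x : ℂ) ^ 2 * Complex.I_sq - hcsC
  have hsin : Real.sin x ≠ 0 := by
    intro h
    rw [h] at h1z
    apply hne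
    simp at h1z
    linear_combination -h1z
  have hnorm : ‖1 - z‖ ^ 2 = 4 * Real.sin x ^ 2 := by
    rw [h1z]
    simp only [norm_mul, norm_neg, Complex.norm_ofNat, Complex.norm_I, Complex.norm_real,
      Complex.norm_exp_ofReal_mul_I, Real.norm_eq_abs, mul_one, mul_pow, sq_abs]
    norm_num
  rw [hnorm] at hle
  obtain ⟨y, hy⟩ : ∃ y : ℝ, y = p / 4 * Real.cos x / Real.sin x := ⟨_, rfl⟩
  have hcay : (1 + z) / (1 - z) = Real.cos x / Real.sin x * Complex.I := by
    have := Complex.exp_ne_zero (x * Complex.I)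
    have hsC : (Real.sin x : ℂ) ≠ 0 := by exact_mod_cast hsin
    rw [h1z, h1z']
    field_simp
    linear_combination (-Real.cos x : ℂ) * Complex.I_sq
  have hyb : |y| ≤ |Real.sin x * Real.cos x| := by
    have hs' := abs_pos.2 hsin
    rw [hy, abs_div, abs_mul, abs_mul, div_le_iff₀ hs', abs_div, abs_of_pos (by norm_num : (0:ℝ) < 4)]
    have h2 : |p| / 4 ≤ |Real.sin x| ^ 2 := by rw [sq_abs]; linarith
    nlinarith [mul_le_mul_of_nonneg_right h2 (abs_nonneg (Real.cos x))]
  have hfx : f p z = Complex.exp ((2 * (x + y) : ℝ) * Complex.I) := by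
    rw [f, hcay]
    conv_lhs => enter [1]; rw [hzx, ← Complex.exp_nat_mul]
    rw [← Complex.exp_add, hy]
    congr 1
    push_cast
    ring
  rw [hfx, Complex.exp_eq_one_iff] at hf
  obtain ⟨n, hn⟩ := hf
  have hn' : x + y = n * Real.pi := by
    have h3 := congrArg Complex.im hn
    have e1 : (((2 * (x + y) : ℝ) : ℂ) * Complex.I).im = 2 * (x + y) := by
      rw [Complex.im_ofReal_mul, Complex.I_im, mul_one]
    have e2 : ((n : ℂ) * (2 * Real.pi * Complex.I)).im = n * (2 * Real.pi) := by simp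
    rw [e1, e2] at h3
    linarith
  have hy1 : |y| < |x| := hyb.trans_lt (abs_sin_mul_cos_lt hx0)
  have hy2 : |y| ≤ 1 / 2 := hyb.trans (abs_sin_mul_cos_le x)
  have hpi := Real.pi_gt_three
  have habs : |x + y| < Real.pi := by
    have := abs_add_le x y
    linarith
  rw [hn', abs_mul, abs_of_pos Real.pi_pos] at habs
  have hn1 : |(n : ℝ)| < 1 := by nlinarith
  have hn0 : n = 0 := by
    rw [← Int.cast_abs] at hn1
    exact Int.abs_lt_one_iff.1 (by exact_mod_cast hn1)
  rw [hn0, Int.cast_zero, zero_mul] at hn'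
  rw [show y = -x by linarith, abs_neg] at hy1
  exact lt_irrefl _ hy1

/-! ### Extension to the closed disk -/

/-- A continuous injective map on a compact set is a homeomorphism onto its image. -/
lemma exists_homeo_of_isCompact {K L : Set ℂ} (hK : IsCompact K) {g : ℂ → ℂ}
    (hg : ContinuousOn g K) (hi : InjOn g K) (hL : g '' K = L) :
    ∃ e : K ≃ₜ L, ∀ z : K, (e z : ℂ) = g z := by
  subst hL
  have := isCompact_iff_compactSpace.1 hK
  have hc : Continuous (Equiv.Set.imageOfInjOn g K hi) :=
    (continuousOn_iff_continuous_domRestrict.1 hg).subtype_mk _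
  exact ⟨hc.homeoOfEquivCompactToT2, fun _ => rfl⟩

lemma chi2_image {s : ℝ} (hs : 0 < s) (t : ℝ) :
    chi2 s t '' ball 0 1 = f (s - t) '' Omega s := by
  rw [chi2, image_comp, chi_image hs]

lemma closure_chi2_image {s : ℝ} (hs : 0 < s) (t : ℝ) :
    f (s - t) '' closure (Omega s) = closure (chi2 s t '' ball 0 1) := by
  rw [chi2_image hs, image_closure_of_isCompact (isCompact_closure_Omega s)
    (continuousOn_f_closure hs _)]

/-- Both `f_s` and `f_{s-t}` are homeomorphisms from the closure of `Ω_s` onto their images; the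
extension is the second after the inverse of the first. -/
theorem extendsToHomeo_chi2 {s t : ℝ} (hs : 0 < s) (hp : |s - t| ≤ s) :
    ExtendsToHomeo (chi2 s t) := by
  have hK := isCompact_closure_Omega s
  have hi := injOn_f_closure hs (abs_of_pos hs).le
  obtain ⟨e₁, h₁⟩ := exists_homeo_of_isCompact hK (continuousOn_f_closure hs s) hi
    (L := closedBall 0 1) (by
      rw [image_closure_of_isCompact hK (continuousOn_f_closure hs s), (bijOn_f hs).image_eq,
        closure_ball _ one_ne_zero])
  obtain ⟨e₂, h₂⟩ := exists_homeo_of_isCompact hK (continuousOn_f_closure hs (s - t))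
    (injOn_f_closure hs hp) (closure_chi2_image hs t)
  refine ⟨e₁.symm.trans e₂, fun z hz => ?_⟩
  have hz' : (e₁.symm z : ℂ) = chi s z := by
    refine hi (e₁.symm z).2 (subset_closure (chi_mem hs hz)) ?_
    rw [← h₁, e₁.apply_symm_apply, f_chi hs hz]
  rw [Homeomorph.trans_apply, h₂, hz']
  rfl

end FreeUnitary

theorem mainTheorem6 (s t : ℝ) (hs : 0 < s) (ht : 0 < t) :
    -- `χ_s` is well defined on the disk, and `f_{s-t}` on the closure of `Ω_s`
    BijOn (FreeUnitary.f s) (FreeUnitary.Omega s) (ball (0 : ℂ) 1) ∧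
    (1 : ℂ) ∉ closure (FreeUnitary.Omega s) ∧
    -- the image of the closure of `Ω_s` under `f_{s-t}`
    MapsTo (FreeUnitary.f (s - t)) (closure (FreeUnitary.Omega s)) (closedBall (0 : ℂ) 1) ∧
    MapsTo (FreeUnitary.f (s - t)) (closure (FreeUnitary.Omega s) ∩ ball (0 : ℂ) 1)
      (ball (0 : ℂ) 1) ∧
    MapsTo (FreeUnitary.f (s - t)) (closure (FreeUnitary.Omega s) ∩ sphere (0 : ℂ) 1)
      (sphere (0 : ℂ) 1) ∧
    (4 < s →
      MapsTo (FreeUnitary.f (s - t)) (closure (FreeUnitary.Omega s)) (ball (0 : ℂ) 1)) ∧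
    -- the map `χ_{s,t}`
    (t / 2 ≤ s →
      FreeUnitary.IsConformalOn (FreeUnitary.chi2 s t) (ball (0 : ℂ) 1) ∧
      FreeUnitary.chi2 s t '' ball (0 : ℂ) 1 ⊆ ball (0 : ℂ) 1 ∧
      FreeUnitary.ExtendsToHomeo (FreeUnitary.chi2 s t) ∧
      (1 : ℂ) ∉ closure (FreeUnitary.chi2 s t '' ball (0 : ℂ) 1)) := by
  open FreeUnitary in
  have hlt : s - t < s := by linarith
  have hball : MapsTo (f (s - t)) (closure (Omega s) ∩ ball (0 : ℂ) 1) (ball (0 : ℂ) 1) :=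
    fun z hz => mem_ball_zero_iff.2
      (norm_f_lt_of_mem_closure hs hlt hz.1 (mem_ball_zero_iff.1 hz.2))
  have hsph : MapsTo (f (s - t)) (closure (Omega s) ∩ sphere (0 : ℂ) 1) (sphere (0 : ℂ) 1) :=
    fun z hz => mem_sphere_zero_iff_norm.2
      (norm_f_of_norm_eq_one _ (mem_sphere_zero_iff_norm.1 hz.2))
  refine ⟨bijOn_f hs, fun h => ne_one_of_mem_closure hs h rfl, fun z hz => ?_, hball, hsph,
    fun h4 z hz => hball ⟨hz, mem_ball_zero_iff.2 ?_⟩, fun h => ?_⟩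
  · rcases (norm_le_of_mem_closure hz).lt_or_eq with h | h
    · exact ball_subset_closedBall (hball ⟨hz, mem_ball_zero_iff.2 h⟩)
    · exact sphere_subset_closedBall (hsph ⟨hz, mem_sphere_zero_iff_norm.2 h⟩)
  -- A point of the circle would give `s ≤ |1 - z|² ≤ 4`.
  · refine (norm_le_of_mem_closure hz).lt_of_ne fun h => ?_
    have h1 := mul_norm_le_of_mem_closure hs hz
    have h2 := norm_sub_le (1 : ℂ) z
    rw [norm_one, h] at h2
    rw [h] at h1
    nlinarith [norm_nonneg (1 - z)]
  -- The lower bound `-s ≤ s - t` is exactly `t / 2 ≤ s`.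
  · have hp : |s - t| ≤ s := abs_le.2 ⟨by linarith, hlt.le⟩
    refine ⟨⟨fun w hw => ?_, ?_⟩, ?_, extendsToHomeo_chi2 hs hp, ?_⟩
    · have hz := norm_lt_of_mem_Omega (chi_mem hs hw)
      exact ((hasStrictDerivAt_f (s - t) (ne_one_of_norm_lt_one hz)).hasDerivAt.differentiableAt.comp
        w (differentiableAt_chi hs hw)).differentiableWithinAt
    · refine ((injOn_f_closure hs hp).mono subset_closure).comp ?_ fun w hw => chi_mem hs hw
      intro w hw w' hw' heq
      rw [← f_chi hs hw, heq, f_chi hs hw']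
    · rw [chi2_image hs]
      rintro _ ⟨z, hz, rfl⟩
      exact hball ⟨subset_closure hz, hz.1⟩
    · rw [← closure_chi2_image hs]
      rintro ⟨z, hz, hz1⟩
      rcases (norm_le_of_mem_closure hz).lt_or_eq with h | h
      · have := norm_f_lt_of_mem_closure hs hlt hz h
        rw [hz1, norm_one] at this
        exact lt_irrefl _ this
      · exact f_ne_one_of_mem_closure hs hp hz h hz1
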